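/- Let $(\Omega,\mathcal A,\mu)$ be a finite measure space. A Young function is an even, continuous, convex function $\varphi:\mathbb R\to\mathbb R$ such that $\varphi(x)=0$ if and only if $x=0$, and $\varphi(x)/x\to\infty$ and $\varphi(x)\to\infty$ as $x\to\infty$. Write $\varphi\in\Delta_2$ if there are constants $k>0$ and $x_0>0$ with $\varphi(2x)\le k\,\varphi(x)$ for all $x\ge x_0$. The Orlicz space $L^\varphi(\mathcal A)$ is the space of (a.e. classes of) measurable functions $f:\Omega\to\mathbb R$ with $\int_\Omega\varphi(\alpha f)\,d\mu<\infty$ for some $\alpha>0$, normed by $$N_\varphi(f)=\inf\Big\{k>0:\int_\Omega\varphi\Big(\frac{|f|}{k}\Big)\,d\mu\le 1\Big\}.$$ For a $\sigma$-subalgebra $\mathfrak D$ of $\mathcal A$, $E(f\mid\mathfrak D)$ denotes the conditional expectation of $f\in L^\varphi(\mathcal A)$. A sequence $(\mathcal A_n)$ of $\sigma$-subalgebras of $\mathcal A$ is said to converge orthogonally to $\mathfrak D$ in $L^\varphi(\mathcal A)$, written $\mathcal A_n\xrightarrow{\perp}\mathfrak D$, if for every choice of sets $A_n\in\mathcal A_n$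 the sequence $\chi_{A_n}-E(\chi_{A_n}\mid\mathfrak D)$ converges to $0$ weakly in the normed space $L^\varphi(\mathcal A)$. **Corollary.** Let $\varphi\in\Delta_2$ be a Young function, let $(\mathcal A_n)_{n}$ be a sequence of $\sigma$-subalgebras of $\mathcal A$, and let $\underline{\mathcal A}=\bigvee_{m}\bigcap_{n\ge m}\mathcal A_n$ be its lower limit, where $\bigvee$ denotes the generated $\sigma$-algebra. Then $\mathcal A_n\xrightarrow{\perp}\underline{\mathcal A}$ if and only if $$E(f\mid\mathcal A_n)\longrightarrow E(f\mid\underline{\mathcal A})\quad\text{in the norm of } L^\varphi(\mathcal A),\qquad\text{for all } f\in L^\varphi(\mathcal A).$$ -/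

import Mathlib

open MeasureTheory Filter Topology

noncomputable section

/-- A Young function: an even continuous convex function `φ : ℝ → ℝ`, vanishing exactly at `0`,
with `φ x / x → ∞` and `φ x → ∞` as `x → ∞`. -/
structure YoungFunction where
  toFun : ℝ → ℝ
  convexOn' : ConvexOn ℝ Set.univ toFun
  continuous' : Continuous toFun
  eq_zero_iff' : ∀ x, toFun x = 0 ↔ x = 0
  even' : ∀ x, toFun (-x) = toFun x
  tendsto_div' : Tendsto (fun x => toFun x / x) atTop atTop
  tendsto' : Tendsto toFun atTop atTop

instance : CoeFun YoungFunction fun _ => ℝ → ℝ := ⟨YoungFunction.toFun⟩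

/-- The `Δ₂`-condition (for large arguments). -/
def YoungFunction.DeltaTwo (φ : YoungFunction) : Prop :=
  ∃ k > (0 : ℝ), ∃ x₀ > (0 : ℝ), ∀ x, x₀ ≤ x → φ (2 * x) ≤ k * φ x

namespace YoungFunction

variable (φ : YoungFunction)

theorem map_zero : φ 0 = 0 := (φ.eq_zero_iff' 0).2 rfl

theorem map_abs (x : ℝ) : φ |x| = φ x := by
  rcases abs_choice x with h | h <;> rw [h]
  exact φ.even' x

theorem map_smul_le {t : ℝ} (h0 : 0 ≤ t) (h1 : t ≤ 1) (x : ℝ) : φ (t * x) ≤ t * φ x := by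
  have := φ.convexOn'.2 (Set.mem_univ x) (Set.mem_univ 0) h0 (sub_nonneg.2 h1) (by ring)
  simpa [φ.map_zero] using this

theorem nonneg (x : ℝ) : 0 ≤ φ x := by
  have := φ.convexOn'.2 (Set.mem_univ x) (Set.mem_univ (-x)) (by norm_num : (0:ℝ) ≤ 1/2)
    (by norm_num : (0:ℝ) ≤ 1/2) (by norm_num)
  simp only [smul_eq_mul, φ.even'] at this
  rw [show (1/2 * x + 1/2 * -x : ℝ) = 0 by ring, φ.map_zero] at this
  linarith

theorem mono_abs {x y : ℝ} (h : |x| ≤ |y|) : φ x ≤ φ y := by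
  rw [← φ.map_abs x, ← φ.map_abs y]
  rcases eq_or_ne y 0 with rfl | hy
  · have : |x| = 0 := le_antisymm (by simpa using h) (abs_nonneg x)
    rw [this, abs_zero]
  · have hy' : 0 < |y| := abs_pos.2 hy
    have h1 : |x| / |y| ≤ 1 := (div_le_one hy').2 h
    have := φ.map_smul_le (div_nonneg (abs_nonneg x) hy'.le) h1 |y|
    rw [div_mul_cancel₀ _ hy'.ne'] at this
    exact this.trans (mul_le_of_le_one_left (φ.nonneg _) h1)

theorem measurable : Measurable (fun x => ENNReal.ofReal (φ x)) :=
  (ENNReal.continuous_ofReal.comp φ.continuous').measurable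

end YoungFunction

variable {Ω : Type*} {mΩ : MeasurableSpace Ω}

/-- The modular `∫ φ(f) dμ`, as an extended nonnegative number. -/
def orliczModular (φ : YoungFunction) (μ : Measure Ω) (f : Ω → ℝ) : ENNReal :=
  ∫⁻ ω, ENNReal.ofReal (φ (f ω)) ∂μ

/-- `f ∈ L^φ`: `f` is (a.e. equal to) a measurable function and `∫ φ(α f) dμ < ∞` for some
`α > 0`. -/
def MemOrlicz (φ : YoungFunction) (μ : Measure Ω) (f : Ω → ℝ) : Prop :=
  AEStronglyMeasurable f μ ∧ ∃ α > (0 : ℝ), orliczModular φ μ (fun ω => α * f ω) < ⊤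

/-- The Luxemburg norm `N_φ(f) = inf {k > 0 : ∫ φ(|f|/k) dμ ≤ 1}`. -/
def luxemburgNorm (φ : YoungFunction) (μ : Measure Ω) (f : Ω → ℝ) : ℝ :=
  sInf {k : ℝ | 0 < k ∧ orliczModular φ μ (fun ω => |f ω| / k) ≤ 1}

section modular

variable {φ : YoungFunction} {μ : Measure Ω} {f g : Ω → ℝ}

theorem orliczModular_congr (h : f =ᵐ[μ] g) : orliczModular φ μ f = orliczModular φ μ g :=
  lintegral_congr_ae (h.mono fun ω hω => by simp only [hω])

theorem orliczModular_mono (h : ∀ᵐ ω ∂μ, |f ω| ≤ |g ω|) :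
    orliczModular φ μ f ≤ orliczModular φ μ g :=
  lintegral_mono_ae (h.mono fun _ hω => ENNReal.ofReal_le_ofReal (φ.mono_abs hω))

theorem orliczModular_convex (hf : AEStronglyMeasurable f μ) {a b : ℝ} (ha : 0 ≤ a) (hb : 0 ≤ b)
    (hab : a + b = 1) :
    orliczModular φ μ (fun ω => a * f ω + b * g ω) ≤
      ENNReal.ofReal a * orliczModular φ μ f + ENNReal.ofReal b * orliczModular φ μ g := by
  unfold orliczModular
  rw [← lintegral_const_mul' _ _ ENNReal.ofReal_ne_top,
    ← lintegral_const_mul' _ _ ENNReal.ofReal_ne_top,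
    ← lintegral_add_left' (f := fun ω => ENNReal.ofReal a * ENNReal.ofReal (φ (f ω)))
      ((φ.measurable.comp_aemeasurable hf.aemeasurable).const_mul _)]
  refine lintegral_mono fun ω => ?_
  rw [← ENNReal.ofReal_mul ha, ← ENNReal.ofReal_mul hb,
    ← ENNReal.ofReal_add (mul_nonneg ha (φ.nonneg _)) (mul_nonneg hb (φ.nonneg _))]
  exact ENNReal.ofReal_le_ofReal (φ.convexOn'.2 (Set.mem_univ _) (Set.mem_univ _) ha hb hab)

theorem orliczModular_smul_le {t : ℝ} (h0 : 0 ≤ t) (h1 : t ≤ 1) :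
    orliczModular φ μ (fun ω => t * f ω) ≤ ENNReal.ofReal t * orliczModular φ μ f := by
  unfold orliczModular
  rw [← lintegral_const_mul' _ _ ENNReal.ofReal_ne_top]
  refine lintegral_mono fun ω => ?_
  rw [← ENNReal.ofReal_mul h0]
  exact ENNReal.ofReal_le_ofReal (φ.map_smul_le h0 h1 _)

theorem MemOrlicz.congr (hf : MemOrlicz φ μ f) (h : f =ᵐ[μ] g) : MemOrlicz φ μ g := by
  obtain ⟨hm, α, hα, hfin⟩ := hf
  refine ⟨hm.congr h, α, hα, ?_⟩
  have e : (fun ω => α * f ω) =ᵐ[μ] fun ω => α * g ω := h.mono fun ω hω => congrArg (α * ·) hω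
  rwa [← orliczModular_congr e]

theorem MemOrlicz.zero : MemOrlicz φ μ (fun _ => (0 : ℝ)) :=
  ⟨aestronglyMeasurable_const, 1, one_pos, by simp [orliczModular, φ.map_zero]⟩

theorem MemOrlicz.add (hf : MemOrlicz φ μ f) (hg : MemOrlicz φ μ g) :
    MemOrlicz φ μ (fun ω => f ω + g ω) := by
  obtain ⟨hfm, α, hα, hfα⟩ := hf
  obtain ⟨hgm, β, hβ, hgβ⟩ := hg
  refine ⟨hfm.add hgm, min α β / 2, by positivity, ?_⟩
  have hmin : 0 < min α β := lt_min hα hβ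
  have key := orliczModular_convex (φ := φ) (μ := μ) (f := fun ω => min α β * f ω)
    (g := fun ω => min α β * g ω) (hfm.const_mul _) (by norm_num : (0:ℝ) ≤ 1/2)
    (by norm_num : (0:ℝ) ≤ 1/2) (by norm_num)
  have e : (fun ω => min α β / 2 * (f ω + g ω)) =
      fun ω => 1/2 * (min α β * f ω) + 1/2 * (min α β * g ω) := by
    funext ω; ring
  rw [e]
  refine key.trans_lt (ENNReal.add_lt_top.2 ⟨ENNReal.mul_lt_top ENNReal.ofReal_lt_top ?_,
    ENNReal.mul_lt_top ENNReal.ofReal_lt_top ?_⟩)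
  · refine (orliczModular_mono (Eventually.of_forall fun ω => ?_)).trans_lt hfα
    rw [abs_mul, abs_mul, abs_of_pos hmin, abs_of_pos hα]
    gcongr
    exact min_le_left _ _
  · refine (orliczModular_mono (Eventually.of_forall fun ω => ?_)).trans_lt hgβ
    rw [abs_mul, abs_mul, abs_of_pos hmin, abs_of_pos hβ]
    gcongr
    exact min_le_right _ _

theorem MemOrlicz.const_mul (hf : MemOrlicz φ μ f) (c : ℝ) : MemOrlicz φ μ (fun ω => c * f ω) := by
  obtain ⟨hfm, α, hα, hfα⟩ := hf
  refine ⟨hfm.const_mul c, α / (|c| + 1), by positivity, ?_⟩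
  refine (orliczModular_mono (Eventually.of_forall fun ω => ?_)).trans_lt hfα
  rw [abs_mul, abs_mul, abs_mul, abs_of_pos hα, abs_of_pos (by positivity : 0 < α / (|c| + 1)),
    ← mul_assoc]
  gcongr
  rw [div_mul_eq_mul_div, div_le_iff₀ (by positivity)]
  nlinarith [abs_nonneg c]

theorem MemOrlicz.of_bound [IsFiniteMeasure μ] (hf : AEStronglyMeasurable f μ) (C : ℝ)
    (h : ∀ᵐ ω ∂μ, |f ω| ≤ C) : MemOrlicz φ μ f := by
  refine ⟨hf, 1, one_pos, ?_⟩
  refine (orliczModular_mono (g := fun _ => C) (h.mono fun ω hω => ?_)).trans_lt ?_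
  · rw [one_mul]; exact hω.trans (le_abs_self C)
  · unfold orliczModular
    rw [lintegral_const]
    exact ENNReal.mul_lt_top ENNReal.ofReal_lt_top (measure_lt_top μ Set.univ)

theorem MemOrlicz.integrable [IsFiniteMeasure μ] (hf : MemOrlicz φ μ f) : Integrable f μ := by
  obtain ⟨hfm, α, hα, hfin⟩ := hf
  obtain ⟨x₀, hx₀⟩ := eventually_atTop.1
    ((φ.tendsto_div'.eventually_ge_atTop 1).and (eventually_gt_atTop 0))
  have hb : ∀ x : ℝ, |x| ≤ |x₀| + φ x := by
    intro x
    rcases le_total x₀ |x| with h | h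
    · obtain ⟨h1, h2⟩ := hx₀ _ h
      rw [le_div_iff₀ h2, one_mul] at h1
      have h3 : φ.toFun |x| = φ.toFun x := φ.map_abs x
      linarith [abs_nonneg x₀]
    · linarith [le_abs_self x₀, φ.nonneg x]
  have hint : Integrable (fun ω => φ (α * f ω)) μ := by
    refine ⟨φ.continuous'.comp_aestronglyMeasurable (hfm.const_mul α), ?_⟩
    rw [hasFiniteIntegral_iff_ofReal (Eventually.of_forall fun ω => φ.nonneg _)]
    exact hfin
  have : Integrable (fun ω => α * f ω) μ := by
    refine ((integrable_const |x₀|).add hint).mono' (hfm.const_mul α)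
      (Eventually.of_forall fun ω => hb _)
  have h2 := this.const_mul α⁻¹
  refine h2.congr (Eventually.of_forall fun ω => ?_)
  field_simp

/-- Conditional expectations of functions in `L^φ` are in `L^φ`. -/
theorem MemOrlicz.condExp [IsFiniteMeasure μ] (m : MeasurableSpace Ω) (hf : MemOrlicz φ μ f) :
    MemOrlicz φ μ (μ[f | m]) := by
  by_cases hm : m ≤ mΩ
  swap
  · rw [condExp_of_not_le hm]; exact MemOrlicz.zero
  have hfi := hf.integrable
  obtain ⟨hfm, α, hα, hfin⟩ := hf
  refine ⟨(stronglyMeasurable_condExp.mono hm).aestronglyMeasurable, α, hα, ?_⟩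
  have hint : Integrable (φ ∘ (α • f)) μ := by
    refine ⟨φ.continuous'.comp_aestronglyMeasurable (hfm.const_mul α), ?_⟩
    refine (hasFiniteIntegral_iff_ofReal (Eventually.of_forall fun ω => ?_)).2 hfin
    exact φ.nonneg _
  have hJ := φ.convexOn'.map_condExp_le_univ (μ := μ) hm φ.continuous'.lowerSemicontinuous
    (hfi.smul α) hint
  have hs := condExp_smul (μ := μ) α f m
  have hle : orliczModular φ μ (fun ω => α * (μ[f | m]) ω) ≤
      ∫⁻ ω, ENNReal.ofReal ((μ[φ ∘ (α • f) | m]) ω) ∂μ := by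
    refine lintegral_mono_ae ?_
    filter_upwards [hJ, hs] with ω h1 h2
    refine ENNReal.ofReal_le_ofReal ?_
    simp only [Function.comp_apply, h2, Pi.smul_apply, smul_eq_mul] at h1
    exact h1
  exact hle.trans_lt (integrable_condExp.lintegral_lt_top)

end modular

/-- The functions in `L^φ`, modulo a.e. equality, as a subspace of the a.e.-classes of measurable
functions. -/
def orliczSubmodule (φ : YoungFunction) (μ : Measure Ω) : Submodule ℝ (Ω →ₘ[μ] ℝ) where
  carrier := {f | MemOrlicz φ μ f}
  add_mem' := fun {f g} hf hg => (MemOrlicz.add hf hg).congr (AEEqFun.coeFn_add f g).symm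
  zero_mem' := MemOrlicz.zero.congr AEEqFun.coeFn_zero.symm
  smul_mem' := fun c f hf => (MemOrlicz.const_mul hf c).congr (AEEqFun.coeFn_smul c f).symm

/-- The Orlicz space `L^φ(μ)`: classes of functions in `L^φ` modulo a.e. equality. -/
def OrliczSpace (φ : YoungFunction) (μ : Measure Ω) : Type _ := orliczSubmodule φ μ

instance (φ : YoungFunction) (μ : Measure Ω) : AddCommGroup (OrliczSpace φ μ) :=
  inferInstanceAs (AddCommGroup (orliczSubmodule φ μ))

instance (φ : YoungFunction) (μ : Measure Ω) : Module ℝ (OrliczSpace φ μ) :=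
  inferInstanceAs (Module ℝ (orliczSubmodule φ μ))

/-- The class in `L^φ` of a function in `L^φ`. -/
def MemOrlicz.toOrlicz {φ : YoungFunction} {μ : Measure Ω} {f : Ω → ℝ} (hf : MemOrlicz φ μ f) :
    OrliczSpace φ μ :=
  ⟨AEEqFun.mk f hf.1, hf.congr (AEEqFun.coeFn_mk f hf.1).symm⟩

theorem absorbent_of_eventually {E : Type*} [AddCommGroup E] [Module ℝ E] {s : Set E}
    (h : ∀ x : E, ∀ᶠ c : ℝ in 𝓝 0, c • x ∈ s) : Absorbent ℝ s :=
  absorbent_iff_eventually_nhdsNE_zero.2 fun x => (h x).filter_mono nhdsWithin_le_nhds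

section norm

variable {φ : YoungFunction} {μ : Measure Ω}

instance : Norm (OrliczSpace φ μ) := ⟨fun f => luxemburgNorm φ μ f.1⟩

theorem orlicz_norm_def (f : OrliczSpace φ μ) : ‖f‖ = luxemburgNorm φ μ f.1 := rfl

theorem orlicz_coe_smul (c : ℝ) (f : OrliczSpace φ μ) :
    ((c • f : OrliczSpace φ μ).1 : Ω → ℝ) =ᵐ[μ] fun ω => c * f.1 ω :=
  AEEqFun.coeFn_smul c f.1

theorem orlicz_norm_eq_gauge (f : OrliczSpace φ μ) :
    ‖f‖ = gauge {g : OrliczSpace φ μ | orliczModular φ μ g.1 ≤ 1} f := by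
  rw [gauge_def', orlicz_norm_def, luxemburgNorm]
  congr 1
  ext k
  simp only [Set.mem_ofPred_eq, Set.mem_Ioi]
  refine and_congr_right fun hk => ?_
  rw [orliczModular_congr (orlicz_coe_smul k⁻¹ f)]
  have : orliczModular φ μ (fun ω => |f.1 ω| / k) = orliczModular φ μ (fun ω => k⁻¹ * f.1 ω) := by
    unfold orliczModular
    refine lintegral_congr fun ω => ?_
    simp only []
    rw [← φ.map_abs (k⁻¹ * _), abs_mul, abs_of_pos (inv_pos.2 hk), div_eq_inv_mul]
  rw [this]

theorem orlicz_balanced : Balanced ℝ {g : OrliczSpace φ μ | orliczModular φ μ g.1 ≤ 1} := by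
  rw [balanced_iff_smul_mem]
  intro a ha f hf
  simp only [Set.mem_ofPred_eq] at hf ⊢
  rw [orliczModular_congr (orlicz_coe_smul a f)]
  refine (orliczModular_mono (Eventually.of_forall fun ω => ?_)).trans hf
  rw [abs_mul]
  exact mul_le_of_le_one_left (abs_nonneg _) ha

theorem orlicz_convex : Convex ℝ {g : OrliczSpace φ μ | orliczModular φ μ g.1 ≤ 1} := by
  intro f hf g hg a b ha hb hab
  simp only [Set.mem_ofPred_eq] at hf hg ⊢
  have e : ((a • f + b • g : OrliczSpace φ μ).1 : Ω → ℝ) =ᵐ[μ]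
      fun ω => a * f.1 ω + b * g.1 ω := by
    filter_upwards [AEEqFun.coeFn_add (a • f : OrliczSpace φ μ).1 (b • g : OrliczSpace φ μ).1,
      orlicz_coe_smul a f, orlicz_coe_smul b g] with ω h1 h2 h3
    simp only [Pi.add_apply, h2, h3] at h1
    exact h1
  rw [orliczModular_congr e]
  refine (orliczModular_convex (AEEqFun.aestronglyMeasurable f.1) ha hb hab).trans ?_
  calc _ ≤ ENNReal.ofReal a * 1 + ENNReal.ofReal b * 1 := by gcongr
    _ = 1 := by rw [mul_one, mul_one, ← ENNReal.ofReal_add ha hb, hab, ENNReal.ofReal_one]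

theorem orlicz_absorbent : Absorbent ℝ {g : OrliczSpace φ μ | orliczModular φ μ g.1 ≤ 1} := by
  refine absorbent_of_eventually fun f => ?_
  obtain ⟨-, α, hα, hfin⟩ := f.2
  set M := (orliczModular φ μ fun ω => α * f.1 ω).toReal with hM
  have hM0 : 0 ≤ M := ENNReal.toReal_nonneg
  have hr : 0 < α / (M + 1) := by positivity
  have hball : ∀ᶠ c : ℝ in 𝓝 0, |c| < α / (M + 1) := by
    have := (continuous_abs (G := ℝ)).tendsto 0
    rw [abs_zero] at this
    exact this.eventually_lt_const hr
  refine hball.mono fun c hc => ?_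
  simp only [Set.mem_ofPred_eq]
  rw [orliczModular_congr (orlicz_coe_smul c f)]
  have h1 : orliczModular φ μ (fun ω => c * f.1 ω) ≤
      orliczModular φ μ (fun ω => (1 / (M + 1)) * (α * f.1 ω)) := by
    refine orliczModular_mono (Eventually.of_forall fun ω => ?_)
    rw [← mul_assoc, abs_mul, abs_mul (1 / (M + 1) * α), one_div_mul_eq_div, abs_of_pos hr]
    gcongr
  have h2 : 1 / (M + 1) ≤ 1 := by
    rw [div_le_one (by positivity)]; linarith
  refine h1.trans ((orliczModular_smul_le (by positivity) h2).trans ?_)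
  rw [← ENNReal.ofReal_toReal hfin.ne, ← ENNReal.ofReal_mul (by positivity)]
  refine ENNReal.ofReal_le_one.2 ?_
  change 1 / (M + 1) * M ≤ 1
  rw [one_div_mul_eq_div, div_le_one (by positivity)]
  linarith

theorem orlicz_eq_zero {f : OrliczSpace φ μ} (hf : ‖f‖ = 0) : f = 0 := by
  have key : ∀ n : ℕ, (n + 1 : ENNReal) * orliczModular φ μ f.1 ≤ 1 := by
    intro n
    have hpos : (0 : ℝ) < 1 / (n + 1) := by positivity
    rw [orlicz_norm_eq_gauge] at hf
    obtain ⟨b, hb0, hb1, g, hg, hgf⟩ := exists_lt_of_gauge_lt orlicz_absorbent (hf.trans_lt hpos)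
    simp only at hgf
    have hg' : orliczModular φ μ (fun ω => b⁻¹ * f.1 ω) ≤ 1 := by
      rw [← orliczModular_congr (orlicz_coe_smul b⁻¹ f), ← hgf, inv_smul_smul₀ hb0.ne']
      exact hg
    have hn1 : (0 : ℝ) < n + 1 := by positivity
    have h1 : orliczModular φ μ f.1 ≤ ENNReal.ofReal (1 / (n + 1)) *
        orliczModular φ μ (fun ω => (n + 1) * f.1 ω) := by
      have := orliczModular_smul_le (φ := φ) (μ := μ) (f := fun ω => ((n : ℝ) + 1) * f.1 ω)
        hpos.le (by rw [div_le_one hn1]; linarith [(Nat.cast_nonneg n : (0:ℝ) ≤ n)])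
      refine le_trans (le_of_eq ?_) this
      congr 1
      funext ω
      field_simp
    have h2 : orliczModular φ μ (fun ω => (n + 1) * f.1 ω) ≤ 1 := by
      refine (orliczModular_mono (Eventually.of_forall fun ω => ?_)).trans hg'
      rw [abs_mul, abs_mul, abs_of_pos hn1, abs_of_pos (inv_pos.2 hb0)]
      gcongr
      rw [le_inv_comm₀ hn1 hb0, ← one_div]
      exact hb1.le
    have h3 : (n + 1 : ENNReal) = ENNReal.ofReal (n + 1) := by
      rw [ENNReal.ofReal_add (Nat.cast_nonneg n) zero_le_one]; simp
    calc (n + 1 : ENNReal) * orliczModular φ μ f.1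
        ≤ ENNReal.ofReal (n + 1) * (ENNReal.ofReal (1 / (n + 1)) * 1) := by
          rw [h3]; gcongr; exact h1.trans (by gcongr)
      _ = 1 := by
          rw [mul_one, ← ENNReal.ofReal_mul hn1.le, mul_one_div_cancel hn1.ne', ENNReal.ofReal_one]
  have h0 : orliczModular φ μ f.1 = 0 := by
    by_contra hne
    obtain ⟨n, hn⟩ := ENNReal.exists_nat_mul_gt hne ENNReal.one_ne_top
    refine absurd (key n) (not_le.2 (hn.trans_le ?_))
    gcongr
    exact le_self_add
  have hm : AEMeasurable (fun ω => ENNReal.ofReal (φ (f.1 ω))) μ :=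
    φ.measurable.comp_aemeasurable (AEEqFun.aestronglyMeasurable f.1).aemeasurable
  have h4 := (lintegral_eq_zero_iff' hm).1 h0
  refine Subtype.ext (AEEqFun.ext ?_)
  filter_upwards [h4, AEEqFun.coeFn_zero (α := Ω) (μ := μ) (β := ℝ)] with ω h5 h6
  have h7 : φ (f.1 ω) = 0 := le_antisymm (ENNReal.ofReal_eq_zero.1 h5) (φ.nonneg _)
  rw [(φ.eq_zero_iff' _).1 h7]
  exact h6.symm

theorem orlicz_core : NormedSpace.Core ℝ (OrliczSpace φ μ) where
  norm_nonneg f := by rw [orlicz_norm_eq_gauge]; exact gauge_nonneg _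
  norm_smul c f := by
    rw [orlicz_norm_eq_gauge, orlicz_norm_eq_gauge]; exact gauge_smul orlicz_balanced c f
  norm_triangle f g := by
    rw [orlicz_norm_eq_gauge, orlicz_norm_eq_gauge, orlicz_norm_eq_gauge]
    exact gauge_add_le orlicz_convex orlicz_absorbent f g
  norm_eq_zero_iff f := by
    refine ⟨orlicz_eq_zero, ?_⟩
    rintro rfl
    rw [orlicz_norm_eq_gauge]; exact gauge_zero

/-- `L^φ` is a normed group under the Luxemburg norm. -/
instance : NormedAddCommGroup (OrliczSpace φ μ) := NormedAddCommGroup.ofCore orlicz_core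

instance : NormedSpace ℝ (OrliczSpace φ μ) := NormedSpace.ofCore orlicz_core

end norm

/-- The conditional expectation `f ↦ E(f | m)` as a map `L^φ → L^φ`. -/
def orliczCondExp (φ : YoungFunction) (μ : Measure Ω) [IsFiniteMeasure μ] (m : MeasurableSpace Ω)
    (f : OrliczSpace φ μ) : OrliczSpace φ μ :=
  (MemOrlicz.condExp m f.2).toOrlicz

/-- The orthogonal complement `f - E(f | m)` of the conditional expectation. -/
def orliczCondExpPerp (φ : YoungFunction) (μ : Measure Ω) [IsFiniteMeasure μ]
    (m : MeasurableSpace Ω) (f : OrliczSpace φ μ) : OrliczSpace φ μ :=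
  f - orliczCondExp φ μ m f

theorem memOrlicz_indicator (φ : YoungFunction) (μ : Measure Ω) [IsFiniteMeasure μ] {S : Set Ω}
    (hS : MeasurableSet S) : MemOrlicz φ μ (S.indicator fun _ => (1 : ℝ)) := by
  refine MemOrlicz.of_bound (aestronglyMeasurable_const.indicator hS) 1
    (Eventually.of_forall fun ω => ?_)
  by_cases h : ω ∈ S <;> simp [h]

/-- The characteristic function of a measurable set, as an element of `L^φ`. -/
def orliczIndicator (φ : YoungFunction) (μ : Measure Ω) [IsFiniteMeasure μ] {S : Set Ω}
    (hS : MeasurableSet S) : OrliczSpace φ μ :=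
  (memOrlicz_indicator φ μ hS).toOrlicz

/-- Weak convergence of a sequence in a real normed space: convergence against every continuous
linear functional. -/
def WeaklyConverges {E : Type*} [NormedAddCommGroup E] [NormedSpace ℝ E] (x : ℕ → E) (y : E) :
    Prop :=
  ∀ l : E →L[ℝ] ℝ, Tendsto (fun n => l (x n)) atTop (𝓝 (l y))

/-- Orthogonal convergence in `L^φ` of a sequence `A n` of sub-σ-algebras to a σ-algebra `D`:
for all `S n ∈ A n`, the functions `χ_{S n} - E(χ_{S n} | D)` converge weakly to `0` in `L^φ`. -/
def OrthogonallyConverges (φ : YoungFunction) (μ : Measure Ω) [IsFiniteMeasure μ]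
    (A : ℕ → MeasurableSpace Ω) (hA : ∀ n, A n ≤ mΩ) (D : MeasurableSpace Ω) : Prop :=
  ∀ (S : ℕ → Set Ω) (hS : ∀ n, MeasurableSet[A n] (S n)),
    WeaklyConverges
      (fun n => orliczCondExpPerp φ μ D (orliczIndicator φ μ (hA n (S n) (hS n)))) 0

/-- The lower limit `⋁ₘ ⋂_{n ≥ m} A n` of a sequence of σ-algebras. -/
abbrev lowerLimit (A : ℕ → MeasurableSpace Ω) : MeasurableSpace Ω :=
  ⨆ m : ℕ, ⨅ n : ℕ, ⨅ _ : m ≤ n, A n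

end

/-!
Write `D` for the lower limit of the `A n`.  Everything rests on one identity
(`integral_indicator_sub_condExp_mul`): for `S ∈ A n` and integrable `g`,
`∫ (χ_S - E(χ_S | D)) g = ∫_S E(g - E(g | D) | A n)`.
It says that orthogonal convergence, tested against bounded densities `g`, is the `L¹` convergence
of `E(g - E(g | D) | A n)` to `0`.

*From orthogonal convergence to norm convergence.*  A bounded `g` defines a continuous functional
on `L^φ`, so choosing for `S` the sets where `E(g - E(g | D) | A n)` has a fixed sign gives
`E(g - E(g | D) | A n) → 0` in `L¹`.  Also `E(h | A n) → h` in `L¹` for integrable `D`-measurable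
`h` (`tendsto_integral_abs_condExp_condExp_lowerLimit_sub`): by the upward martingale theorem `h` is
close in `L¹` to a function measurable for some `⋂_{n ≥ m} A n`, hence for all later `A n`.
Together, `E(g | A n) → E(g | D)` in `L¹`, and for uniformly bounded sequences `L¹` convergence
implies convergence in `L^φ` (`OrliczSpace.tendsto_zero_of_bounded`).  Under `Δ₂` the bounded
functions are dense in `L^φ`, and conditional expectations are contractions of `L^φ`, so the
convergence extends to all of `L^φ`.

*From norm convergence to orthogonal convergence.*  If `l` is a continuous functional on `L^φ`, then
`S ↦ l(χ_S)` is a signed measure absolutely continuous with respect to `μ`; by the theorem of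
Radon and Nikodym, `l` has an `L¹` density on bounded functions (`exists_integrable_density`).  The functions
`χ_S - E(χ_S | D)` are uniformly bounded, so the density may be taken bounded, and then the identity
applies, because `L^φ` convergence implies `L¹` convergence.
-/

noncomputable section

variable {Ω : Type*} {mΩ : MeasurableSpace Ω}

/-! ### Classes of functions in the Orlicz space -/

section classes

variable {φ : YoungFunction} {μ : Measure Ω} {f g : Ω → ℝ}

theorem MemOrlicz.coeFn_toOrlicz (hf : MemOrlicz φ μ f) : (hf.toOrlicz.1 : Ω → ℝ) =ᵐ[μ] f :=
  AEEqFun.coeFn_mk f hf.1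

theorem OrliczSpace.ext {f g : OrliczSpace φ μ} (h : (f.1 : Ω → ℝ) =ᵐ[μ] g.1) : f = g :=
  Subtype.ext (AEEqFun.ext h)

theorem OrliczSpace.coeFn_add (f g : OrliczSpace φ μ) :
    ((f + g : OrliczSpace φ μ).1 : Ω → ℝ) =ᵐ[μ] fun ω => f.1 ω + g.1 ω :=
  AEEqFun.coeFn_add f.1 g.1

theorem OrliczSpace.coeFn_sub (f g : OrliczSpace φ μ) :
    ((f - g : OrliczSpace φ μ).1 : Ω → ℝ) =ᵐ[μ] fun ω => f.1 ω - g.1 ω :=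
  AEEqFun.coeFn_sub f.1 g.1

theorem OrliczSpace.coeFn_zero : ((0 : OrliczSpace φ μ).1 : Ω → ℝ) =ᵐ[μ] fun _ => 0 :=
  AEEqFun.coeFn_zero

theorem MemOrlicz.toOrlicz_add (hf : MemOrlicz φ μ f) (hg : MemOrlicz φ μ g)
    (hfg : MemOrlicz φ μ (f + g)) : hfg.toOrlicz = hf.toOrlicz + hg.toOrlicz := by
  refine OrliczSpace.ext ?_
  filter_upwards [hfg.coeFn_toOrlicz, hf.coeFn_toOrlicz, hg.coeFn_toOrlicz,
    OrliczSpace.coeFn_add hf.toOrlicz hg.toOrlicz] with ω h1 h2 h3 h4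
  rw [h1, h4, h2, h3, Pi.add_apply]

theorem OrliczSpace.integrable [IsFiniteMeasure μ] (f : OrliczSpace φ μ) :
    Integrable (f.1 : Ω → ℝ) μ :=
  MemOrlicz.integrable f.2

theorem coeFn_orliczIndicator [IsFiniteMeasure μ] {S : Set Ω} (hS : MeasurableSet S) :
    ((orliczIndicator φ μ hS).1 : Ω → ℝ) =ᵐ[μ] S.indicator fun _ => (1 : ℝ) :=
  (memOrlicz_indicator φ μ hS).coeFn_toOrlicz

theorem coeFn_orliczCondExp [IsFiniteMeasure μ] (m : MeasurableSpace Ω) (f : OrliczSpace φ μ) :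
    ((orliczCondExp φ μ m f).1 : Ω → ℝ) =ᵐ[μ] μ[f.1 | m] :=
  (MemOrlicz.condExp m f.2).coeFn_toOrlicz

theorem coeFn_orliczCondExp_toOrlicz [IsFiniteMeasure μ] (m : MeasurableSpace Ω)
    (hf : MemOrlicz φ μ f) :
    ((orliczCondExp φ μ m hf.toOrlicz).1 : Ω → ℝ) =ᵐ[μ] μ[f | m] :=
  (coeFn_orliczCondExp m _).trans (condExp_congr_ae hf.coeFn_toOrlicz)

end classes

/-! ### The Luxemburg norm, the modular and the `L¹` norm -/

section norm

variable {φ : YoungFunction} {μ : Measure Ω}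

theorem luxemburgNorm_le {f : Ω → ℝ} {k : ℝ} (hk : 0 < k)
    (h : orliczModular φ μ (fun ω => f ω / k) ≤ 1) : luxemburgNorm φ μ f ≤ k := by
  refine csInf_le ⟨0, fun _ h => h.1.le⟩ ⟨hk, le_trans (le_of_eq ?_) h⟩
  unfold orliczModular
  refine lintegral_congr fun ω => ?_
  simp only []
  rw [← φ.map_abs (f ω / k), abs_div, abs_of_pos hk]

theorem exists_orliczModular_le_one_of_norm_lt {f : OrliczSpace φ μ} {k : ℝ} (h : ‖f‖ < k) :
    ∃ b, 0 < b ∧ b < k ∧ orliczModular φ μ (fun ω => f.1 ω / b) ≤ 1 := by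
  rw [orlicz_norm_eq_gauge] at h
  obtain ⟨b, hb0, hb1, g, hg, hgf⟩ := exists_lt_of_gauge_lt orlicz_absorbent h
  refine ⟨b, hb0, hb1, ?_⟩
  simp only at hgf
  have e : (fun ω => f.1 ω / b) = fun ω => b⁻¹ * f.1 ω := by
    funext ω; rw [div_eq_inv_mul]
  rw [e, ← orliczModular_congr (orlicz_coe_smul b⁻¹ f), ← hgf, inv_smul_smul₀ hb0.ne']
  exact hg

/-- On a set of uniformly bounded functions, `L¹` convergence implies convergence in the Luxemburg
norm, because a convex function vanishing at `0` lies below its chord on `[0, C]`. -/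
theorem OrliczSpace.tendsto_zero_of_bounded [IsFiniteMeasure μ] {ι : Type*} {L : Filter ι}
    {u : ι → OrliczSpace φ μ} {C : ℝ} (hC : ∀ i, ∀ᵐ ω ∂μ, |(u i).1 ω| ≤ C)
    (h : Tendsto (fun i => ∫ ω, |(u i).1 ω| ∂μ) L (𝓝 0)) : Tendsto u L (𝓝 0) := by
  -- enlarge the bound to a positive one
  set D := max C 1 with hD
  have hD0 : 0 < D := lt_max_of_lt_right one_pos
  rw [tendsto_zero_iff_norm_tendsto_zero, Metric.tendsto_nhds]
  intro ε hε
  set M := φ (D / (ε / 2)) with hM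
  have hM0 : 0 ≤ M := φ.nonneg _
  have hlim : Tendsto (fun i => M / D * ∫ ω, |(u i).1 ω| ∂μ) L (𝓝 0) := by
    simpa using h.const_mul (M / D)
  filter_upwards [hlim.eventually_le_const one_pos] with i hi
  have hle : luxemburgNorm φ μ (u i).1 ≤ ε / 2 := by
    refine luxemburgNorm_le (half_pos hε) ?_
    have hint : Integrable (fun ω => M / D * |(u i).1 ω|) μ := (u i).integrable.abs.const_mul _
    calc orliczModular φ μ (fun ω => (u i).1 ω / (ε / 2))
        ≤ ∫⁻ ω, ENNReal.ofReal (M / D * |(u i).1 ω|) ∂μ := by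
          refine lintegral_mono_ae ((hC i).mono fun ω hω => ENNReal.ofReal_le_ofReal ?_)
          have h1 : |(u i).1 ω| / D ≤ 1 := (div_le_one hD0).2 (hω.trans (le_max_left _ _))
          have h2 := φ.map_smul_le (div_nonneg (abs_nonneg _) hD0.le) h1 (D / (ε / 2))
          have h3 : |(u i).1 ω| / D * (D / (ε / 2)) = |(u i).1 ω / (ε / 2)| := by
            rw [abs_div, abs_of_pos (half_pos hε)]; field_simp
          rw [h3, φ.map_abs] at h2
          exact h2.trans_eq (by rw [hM]; ring)
      _ = ENNReal.ofReal (∫ ω, M / D * |(u i).1 ω| ∂μ) :=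
          (ofReal_integral_eq_lintegral_ofReal hint
            (Eventually.of_forall fun ω => by positivity)).symm
      _ ≤ 1 := by
          rw [integral_const_mul]
          exact ENNReal.ofReal_le_one.2 hi
  rw [dist_zero_right, norm_norm]
  exact hle.trans_lt (half_lt_self hε)

/-- On a finite measure space `L^φ` embeds continuously into `L¹`. -/
theorem OrliczSpace.exists_integral_abs_le [IsFiniteMeasure μ] :
    ∃ K : ℝ, 0 ≤ K ∧ ∀ f : OrliczSpace φ μ, ∫ ω, |f.1 ω| ∂μ ≤ K * ‖f‖ := by
  obtain ⟨x₀, hx₀⟩ := eventually_atTop.1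
    ((φ.tendsto_div'.eventually_ge_atTop 1).and (eventually_gt_atTop 0))
  -- superlinearity of `φ` bounds `|x|` by `φ x` up to a constant
  have hb : ∀ x : ℝ, |x| ≤ |x₀| + φ x := by
    intro x
    rcases le_total x₀ |x| with h | h
    · obtain ⟨h1, h2⟩ := hx₀ _ h
      rw [le_div_iff₀ h2, one_mul] at h1
      have h3 : φ.toFun |x| = φ.toFun x := φ.map_abs x
      linarith [abs_nonneg x₀]
    · linarith [le_abs_self x₀, φ.nonneg x]
  set K := |x₀| * μ.real Set.univ + 1 with hK
  have hK0 : 0 < K := by positivity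
  refine ⟨K, hK0.le, fun f => ?_⟩
  rw [← div_le_iff₀' hK0]
  refine le_of_forall_gt_imp_ge_of_dense fun k hk => ?_
  obtain ⟨b, hb0, hbk, hmod⟩ := exists_orliczModular_le_one_of_norm_lt hk
  have hmeas : AEStronglyMeasurable (fun ω => φ (f.1 ω / b)) μ :=
    φ.continuous'.comp_aestronglyMeasurable (f.integrable.div_const b).1
  have hnn : 0 ≤ᵐ[μ] fun ω => φ (f.1 ω / b) := Eventually.of_forall fun ω => φ.nonneg _
  have hint : Integrable (fun ω => φ (f.1 ω / b)) μ :=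
    ⟨hmeas, (hasFiniteIntegral_iff_ofReal hnn).2 (hmod.trans_lt ENNReal.one_lt_top)⟩
  have h1 : ∫ ω, φ (f.1 ω / b) ∂μ ≤ 1 := by
    rw [integral_eq_lintegral_of_nonneg_ae hnn hmeas]
    exact ENNReal.toReal_le_of_le_ofReal zero_le_one
      (by rw [ENNReal.ofReal_one]; exact hmod)
  have h2 : ∫ ω, |f.1 ω| / b ∂μ ≤ K := by
    calc ∫ ω, |f.1 ω| / b ∂μ ≤ ∫ ω, (|x₀| + φ (f.1 ω / b)) ∂μ := by
          refine integral_mono (f.integrable.abs.div_const b) ((integrable_const _).add hint)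
            fun ω => ?_
          have := hb (f.1 ω / b)
          rwa [abs_div, abs_of_pos hb0] at this
      _ = |x₀| * μ.real Set.univ + ∫ ω, φ (f.1 ω / b) ∂μ := by
          rw [integral_add (integrable_const _) hint, integral_const, smul_eq_mul, mul_comm]
      _ ≤ K := by rw [hK]; gcongr
  rw [integral_div, div_le_iff₀ hb0] at h2
  rw [div_le_iff₀' hK0]
  exact h2.trans (by gcongr)

theorem OrliczSpace.tendsto_integral_abs_sub [IsFiniteMeasure μ] {u : ℕ → OrliczSpace φ μ}
    {f : OrliczSpace φ μ} (h : Tendsto u atTop (𝓝 f)) :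
    Tendsto (fun n => ∫ ω, |(u n).1 ω - f.1 ω| ∂μ) atTop (𝓝 0) := by
  obtain ⟨K, -, hK⟩ := OrliczSpace.exists_integral_abs_le (φ := φ) (μ := μ)
  have h1 : Tendsto (fun n => K * ‖u n - f‖) atTop (𝓝 0) := by
    simpa using (tendsto_iff_norm_sub_tendsto_zero.1 h).const_mul K
  refine squeeze_zero (fun n => integral_nonneg fun ω => abs_nonneg _) (fun n => ?_) h1
  refine le_of_eq_of_le (integral_congr_ae ?_) (hK (u n - f))
  filter_upwards [OrliczSpace.coeFn_sub (u n) f] with ω hω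
  rw [hω]

/-- Conditional expectation is a contraction of `L^φ`, by Jensen's inequality. -/
theorem norm_orliczCondExp_le [IsFiniteMeasure μ] {m : MeasurableSpace Ω} (hm : m ≤ mΩ)
    (f : OrliczSpace φ μ) : ‖orliczCondExp φ μ m f‖ ≤ ‖f‖ := by
  refine le_of_forall_gt_imp_ge_of_dense fun k hk => ?_
  obtain ⟨b, hb0, hbk, hmod⟩ := exists_orliczModular_le_one_of_norm_lt hk
  refine (luxemburgNorm_le hb0 ?_).trans hbk.le
  have hmeas : AEStronglyMeasurable[mΩ] (φ ∘ (b⁻¹ • (f.1 : Ω → ℝ))) μ :=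
    φ.continuous'.comp_aestronglyMeasurable (f.integrable.1.const_smul b⁻¹)
  have hnn : 0 ≤ᵐ[μ] φ ∘ (b⁻¹ • (f.1 : Ω → ℝ)) := Eventually.of_forall fun ω => φ.nonneg _
  have hlint : ∫⁻ ω, ENNReal.ofReal ((φ ∘ (b⁻¹ • (f.1 : Ω → ℝ))) ω) ∂μ ≤ 1 := by
    refine le_trans (le_of_eq ?_) hmod
    unfold orliczModular
    refine lintegral_congr fun ω => ?_
    simp [div_eq_inv_mul]
  have hint : Integrable (φ ∘ (b⁻¹ • (f.1 : Ω → ℝ))) μ :=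
    ⟨hmeas, (hasFiniteIntegral_iff_ofReal hnn).2 (hlint.trans_lt ENNReal.one_lt_top)⟩
  have hJ := φ.convexOn'.map_condExp_le_univ (μ := μ) hm φ.continuous'.lowerSemicontinuous
    (f.integrable.smul b⁻¹) hint
  have hs := condExp_smul (μ := μ) b⁻¹ (f.1 : Ω → ℝ) m
  calc orliczModular φ μ (fun ω => (orliczCondExp φ μ m f).1 ω / b)
      ≤ ∫⁻ ω, ENNReal.ofReal ((μ[φ ∘ (b⁻¹ • (f.1 : Ω → ℝ)) | m]) ω) ∂μ := by
        refine lintegral_mono_ae ?_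
        filter_upwards [hJ, hs, coeFn_orliczCondExp m f] with ω h1 h2 h3
        refine ENNReal.ofReal_le_ofReal ?_
        simp only [Function.comp_apply, h2, Pi.smul_apply, smul_eq_mul] at h1
        rw [h3, div_eq_inv_mul]
        exact h1
    _ = ENNReal.ofReal (∫ ω, (μ[φ ∘ (b⁻¹ • (f.1 : Ω → ℝ)) | m]) ω ∂μ) :=
        (ofReal_integral_eq_lintegral_ofReal integrable_condExp (condExp_nonneg hnn)).symm
    _ = ∫⁻ ω, ENNReal.ofReal ((φ ∘ (b⁻¹ • (f.1 : Ω → ℝ))) ω) ∂μ := by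
        rw [integral_condExp hm, ofReal_integral_eq_lintegral_ofReal hint hnn]
    _ ≤ 1 := hlint

theorem orliczCondExp_sub [IsFiniteMeasure μ] (m : MeasurableSpace Ω) (f g : OrliczSpace φ μ) :
    orliczCondExp φ μ m (f - g) = orliczCondExp φ μ m f - orliczCondExp φ μ m g := by
  refine OrliczSpace.ext ?_
  filter_upwards [coeFn_orliczCondExp m (f - g), coeFn_orliczCondExp m f, coeFn_orliczCondExp m g,
    OrliczSpace.coeFn_sub (orliczCondExp φ μ m f) (orliczCondExp φ μ m g),
    condExp_congr_ae (m := m) (OrliczSpace.coeFn_sub f g),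
    condExp_sub f.integrable g.integrable m] with ω h1 h2 h3 h4 h5 h6
  rw [h1, h4, h2, h3, h5]
  exact h6

end norm

/-! ### Density of the bounded functions under the `Δ₂`-condition -/

section density

variable {φ : YoungFunction} {μ : Measure Ω}

theorem orliczModular_two_mul_lt_top [IsFiniteMeasure μ] (hφ : φ.DeltaTwo) {f : Ω → ℝ}
    (h : orliczModular φ μ f < ⊤) : orliczModular φ μ (fun ω => 2 * f ω) < ⊤ := by
  obtain ⟨k, hk, x₀, hx₀, hΔ⟩ := hφ
  have hb : ∀ x, φ (2 * x) ≤ φ (2 * x₀) + k * φ x := by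
    intro x
    rw [← φ.map_abs (2 * x), abs_mul, abs_two, ← φ.map_abs x]
    rcases le_total x₀ |x| with h | h
    · exact (hΔ _ h).trans (le_add_of_nonneg_left (φ.nonneg _))
    · refine (φ.mono_abs ?_).trans (le_add_of_nonneg_right (mul_nonneg hk.le (φ.nonneg _)))
      rw [abs_mul, abs_mul, abs_abs, abs_of_pos hx₀]
      gcongr
  calc orliczModular φ μ (fun ω => 2 * f ω)
      ≤ ∫⁻ ω, (ENNReal.ofReal (φ (2 * x₀)) + ENNReal.ofReal k * ENNReal.ofReal (φ (f ω))) ∂μ := by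
        refine lintegral_mono fun ω => ?_
        rw [← ENNReal.ofReal_mul hk.le,
          ← ENNReal.ofReal_add (φ.nonneg _) (mul_nonneg hk.le (φ.nonneg _))]
        exact ENNReal.ofReal_le_ofReal (hb _)
    _ = ENNReal.ofReal (φ (2 * x₀)) * μ Set.univ + ENNReal.ofReal k * orliczModular φ μ f := by
        rw [lintegral_add_left measurable_const, lintegral_const,
          lintegral_const_mul' _ _ ENNReal.ofReal_ne_top, orliczModular]
    _ < ⊤ := ENNReal.add_lt_top.2 ⟨ENNReal.mul_lt_top ENNReal.ofReal_lt_top (measure_lt_top _ _),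
        ENNReal.mul_lt_top ENNReal.ofReal_lt_top h⟩

/-- Under `Δ₂` every multiple of a function in `L^φ` has finite modular. -/
theorem MemOrlicz.orliczModular_mul_lt_top [IsFiniteMeasure μ] (hφ : φ.DeltaTwo) {f : Ω → ℝ}
    (hf : MemOrlicz φ μ f) (c : ℝ) : orliczModular φ μ (fun ω => c * f ω) < ⊤ := by
  obtain ⟨-, α, hα, hfin⟩ := hf
  have key : ∀ n : ℕ, orliczModular φ μ (fun ω => 2 ^ n * α * f ω) < ⊤ := by
    intro n
    induction n with
    | zero => simpa using hfin
    | succ n ih =>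
      have := orliczModular_two_mul_lt_top hφ ih
      refine lt_of_eq_of_lt ?_ this
      congr 1
      funext ω
      ring
  obtain ⟨n, hn⟩ := pow_unbounded_of_one_lt (|c| / α) (one_lt_two (α := ℝ))
  refine (orliczModular_mono (Eventually.of_forall fun ω => ?_)).trans_lt (key n)
  rw [abs_mul, abs_mul, abs_of_pos (by positivity : 0 < 2 ^ n * α)]
  gcongr
  exact ((div_lt_iff₀ hα).1 hn).le

/-- Under `Δ₂` the truncations of `f ∈ L^φ` converge to `f` in norm, hence the bounded functions
are dense. -/
theorem OrliczSpace.exists_bounded_norm_sub_le [IsFiniteMeasure μ] (hφ : φ.DeltaTwo)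
    (f : OrliczSpace φ μ) {ε : ℝ} (hε : 0 < ε) :
    ∃ (g : OrliczSpace φ μ) (C : ℝ), (∀ᵐ ω ∂μ, |g.1 ω| ≤ C) ∧ ‖f - g‖ ≤ ε := by
  set F : Ω → ℝ := (f.1 : Ω → ℝ) with hF
  have hFm : AEStronglyMeasurable F μ := f.integrable.1
  -- the truncation at level `n` is `max (min F n) (-n)`
  have htm : ∀ n : ℕ, AEStronglyMeasurable (fun ω => max (min (F ω) n) (-n)) μ := fun n =>
    (hFm.inf aestronglyMeasurable_const).sup aestronglyMeasurable_const
  have htb : ∀ (n : ℕ) (x : ℝ), |max (min x n) (-n)| ≤ n := fun n x =>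
    abs_le.2 ⟨le_max_right _ _, max_le (min_le_right _ _)
      ((neg_nonpos.2 (Nat.cast_nonneg n)).trans (Nat.cast_nonneg n))⟩
  have hle : ∀ (n : ℕ) (x : ℝ), |x - max (min x n) (-n)| ≤ |x| := by
    intro n x
    have hn : (0 : ℝ) ≤ n := Nat.cast_nonneg n
    rcases le_total x n with h1 | h1 <;> rcases le_total (-(n : ℝ)) x with h2 | h2
    · rw [min_eq_left h1, max_eq_left h2]; simp
    · rw [min_eq_left h1, max_eq_right h2, abs_of_nonpos (by linarith), abs_of_nonpos (by linarith)]
      linarith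
    · rw [min_eq_right h1, max_eq_left (by linarith), abs_of_nonneg (by linarith),
        abs_of_nonneg (by linarith)]
      linarith
    · rw [min_eq_right h1, max_eq_left (by linarith), abs_of_nonneg (by linarith),
        abs_of_nonneg (by linarith)]
      linarith
  have hev : ∀ x : ℝ, ∀ᶠ n : ℕ in atTop, x - max (min x n) (-n) = 0 := by
    intro x
    obtain ⟨N, hN⟩ := exists_nat_ge |x|
    filter_upwards [eventually_ge_atTop N] with n hn
    have h1 : |x| ≤ n := hN.trans (Nat.cast_le.2 hn)
    rw [min_eq_left (abs_le.1 h1).2, max_eq_left (abs_le.1 h1).1, sub_self]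
  have hlim : Tendsto (fun n : ℕ => orliczModular φ μ
      (fun ω => (F ω - max (min (F ω) n) (-n)) / ε)) atTop (𝓝 0) := by
    have := tendsto_lintegral_of_dominated_convergence' (μ := μ)
      (F := fun (n : ℕ) ω => ENNReal.ofReal (φ ((F ω - max (min (F ω) n) (-n)) / ε)))
      (f := fun _ => 0) (fun ω => ENNReal.ofReal (φ (ε⁻¹ * F ω)))
      (fun n => φ.measurable.comp_aemeasurable ((hFm.sub (htm n)).aemeasurable.div_const ε))
      (fun n => Eventually.of_forall fun ω => ENNReal.ofReal_le_ofReal (φ.mono_abs ?_))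
      (MemOrlicz.orliczModular_mul_lt_top hφ f.2 ε⁻¹).ne
      (Eventually.of_forall fun ω => ?_)
    · simpa [orliczModular] using this
    · rw [div_eq_inv_mul, abs_mul, abs_mul]
      exact mul_le_mul_of_nonneg_left (hle n _) (abs_nonneg _)
    · refine tendsto_const_nhds.congr' ?_
      filter_upwards [hev (F ω)] with n hn
      rw [hn, zero_div, φ.map_zero, ENNReal.ofReal_zero]
  obtain ⟨n, hn⟩ := (hlim.eventually_le_const one_pos).exists
  have hmem : MemOrlicz φ μ (fun ω => max (min (F ω) n) (-n)) :=
    MemOrlicz.of_bound (htm n) n (Eventually.of_forall fun ω => htb n _)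
  refine ⟨hmem.toOrlicz, n, ?_, luxemburgNorm_le hε ?_⟩
  · filter_upwards [hmem.coeFn_toOrlicz] with ω hω
    rw [hω]
    exact htb n _
  · refine le_trans (le_of_eq (orliczModular_congr ?_)) hn
    filter_upwards [OrliczSpace.coeFn_sub f hmem.toOrlicz, hmem.coeFn_toOrlicz] with ω h1 h2
    rw [h1, h2]

end density

/-! ### Continuous functionals on the Orlicz space -/

section functionals

variable {φ : YoungFunction} {μ : Measure Ω} [IsFiniteMeasure μ]

theorem orliczIndicator_union {S T : Set Ω} (hS : MeasurableSet S) (hT : MeasurableSet T)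
    (hST : Disjoint S T) :
    orliczIndicator φ μ (hS.union hT) = orliczIndicator φ μ hS + orliczIndicator φ μ hT := by
  refine OrliczSpace.ext ?_
  filter_upwards [coeFn_orliczIndicator (φ := φ) (μ := μ) (hS.union hT),
    coeFn_orliczIndicator (φ := φ) (μ := μ) hS, coeFn_orliczIndicator (φ := φ) (μ := μ) hT,
    OrliczSpace.coeFn_add (orliczIndicator φ μ hS) (orliczIndicator φ μ hT)] with ω h1 h2 h3 h4
  rw [h1, h4, h2, h3, Set.indicator_union_of_disjoint hST]

theorem orliczIndicator_eq_zero {S : Set Ω} (hS : MeasurableSet S) (h : μ S = 0) :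
    orliczIndicator φ μ hS = 0 := by
  refine OrliczSpace.ext ?_
  filter_upwards [coeFn_orliczIndicator (φ := φ) (μ := μ) hS, OrliczSpace.coeFn_zero (φ := φ)
    (μ := μ), measure_eq_zero_iff_ae_notMem.1 h] with ω h1 h2 h3
  rw [h1, h2, Set.indicator_of_notMem h3]

theorem tendsto_orliczIndicator_zero {ι : Type*} {L : Filter ι} {S : ι → Set Ω}
    (hS : ∀ i, MeasurableSet (S i)) (h : Tendsto (fun i => μ.real (S i)) L (𝓝 0)) :
    Tendsto (fun i => orliczIndicator φ μ (hS i)) L (𝓝 0) := by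
  refine OrliczSpace.tendsto_zero_of_bounded (C := 1) (fun i => ?_) (h.congr fun i => ?_)
  · filter_upwards [coeFn_orliczIndicator (φ := φ) (μ := μ) (hS i)] with ω h1
    rw [h1]
    by_cases hω : ω ∈ S i <;> simp [hω]
  · rw [← integral_indicator_one (hS i)]
    refine integral_congr_ae ?_
    filter_upwards [coeFn_orliczIndicator (φ := φ) (μ := μ) (hS i)] with ω h1
    rw [h1]
    by_cases hω : ω ∈ S i <;> simp [hω]

theorem hasSum_orliczIndicator_iUnion {S : ℕ → Set Ω} (hS : ∀ i, MeasurableSet (S i))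
    (hd : Pairwise (Function.onFun Disjoint S)) :
    HasSum (fun i => orliczIndicator φ μ (hS i))
      (orliczIndicator φ μ (MeasurableSet.iUnion hS)) := by
  have hfin : ∀ s : Finset ℕ, MeasurableSet (⋃ i ∈ s, S i) := fun s =>
    s.measurableSet_biUnion fun i _ => hS i
  have hsum : ∀ s : Finset ℕ,
      orliczIndicator φ μ (hfin s) = ∑ i ∈ s, orliczIndicator φ μ (hS i) := by
    intro s
    induction s using Finset.induction_on with
    | empty => rw [Finset.sum_empty]; exact orliczIndicator_eq_zero _ (by simp)
    | insert a s ha ih =>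
      rw [Finset.sum_insert ha, ← ih, ← orliczIndicator_union]
      · congr 1
        simp
      · refine Set.disjoint_iUnion₂_right.2 fun i hi => hd ?_
        rintro rfl
        exact ha hi
  have hsub : ∀ s : Finset ℕ, (⋃ i ∈ s, S i) ⊆ ⋃ i, S i := fun s =>
    Set.iUnion₂_subset fun i _ => Set.subset_iUnion S i
  have hsplit : ∀ s : Finset ℕ, orliczIndicator φ μ (MeasurableSet.iUnion hS) =
      ∑ i ∈ s, orliczIndicator φ μ (hS i) +
        orliczIndicator φ μ ((MeasurableSet.iUnion hS).diff (hfin s)) := by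
    intro s
    rw [← hsum, ← orliczIndicator_union _ _ Set.disjoint_sdiff_right]
    congr 1
    exact (Set.union_sdiff_cancel (hsub s)).symm
  have hreal : HasSum (fun i => μ.real (S i)) (μ.real (⋃ i, S i)) := by
    rw [measureReal_def, measure_iUnion hd hS, ENNReal.tsum_toReal_eq fun i => measure_ne_top μ _]
    refine ENNReal.hasSum_toReal ?_
    rw [← measure_iUnion hd hS]
    exact measure_ne_top μ _
  have htail : Tendsto (fun s : Finset ℕ => μ.real ((⋃ i, S i) \ ⋃ i ∈ s, S i)) atTop (𝓝 0) := by
    have h1 : Tendsto (fun s : Finset ℕ => μ.real (⋃ i, S i) - ∑ i ∈ s, μ.real (S i)) atTop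
        (𝓝 0) := by
      simpa using hreal.const_sub (μ.real (⋃ i, S i))
    refine h1.congr fun s => ?_
    rw [measureReal_sdiff (hsub s) (hfin s), measureReal_biUnion_finset (fun i _ j _ h => hd h)
      (fun i _ => hS i)]
  have h0 := tendsto_orliczIndicator_zero (φ := φ) (μ := μ)
    (fun s => (MeasurableSet.iUnion hS).diff (hfin s)) htail
  have h1 : Tendsto (fun s : Finset ℕ => orliczIndicator φ μ (MeasurableSet.iUnion hS) -
      orliczIndicator φ μ ((MeasurableSet.iUnion hS).diff (hfin s))) atTop
      (𝓝 (orliczIndicator φ μ (MeasurableSet.iUnion hS))) := by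
    simpa using h0.const_sub (orliczIndicator φ μ (MeasurableSet.iUnion hS))
  refine h1.congr fun s => ?_
  nth_rw 1 [hsplit s]
  abel

open Classical in
/-- The signed measure `S ↦ l(χ_S)` of a continuous functional `l` on `L^φ`, with value `0`
on the non-measurable sets. -/
def functionalMeasure (l : OrliczSpace φ μ →L[ℝ] ℝ) : SignedMeasure Ω where
  measureOf' S := if hS : MeasurableSet S then l (orliczIndicator φ μ hS) else 0
  empty' := by
    rw [dif_pos MeasurableSet.empty, orliczIndicator_eq_zero _ measure_empty, map_zero]
  not_measurable' S hS := dif_neg hS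
  m_iUnion' S hS hd := by
    rw [dif_pos (MeasurableSet.iUnion hS)]
    simp_rw [dif_pos (hS _)]
    exact (hasSum_orliczIndicator_iUnion hS hd).mapL l

theorem functionalMeasure_apply (l : OrliczSpace φ μ →L[ℝ] ℝ) {S : Set Ω} (hS : MeasurableSet S) :
    functionalMeasure l S = l (orliczIndicator φ μ hS) :=
  dif_pos hS

theorem functionalMeasure_absolutelyContinuous (l : OrliczSpace φ μ →L[ℝ] ℝ) :
    functionalMeasure l ≪ᵥ μ.toENNRealVectorMeasure := by
  refine VectorMeasure.AbsolutelyContinuous.mk fun S hS h => ?_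
  rw [Measure.toENNRealVectorMeasure_apply_measurable hS] at h
  rw [functionalMeasure_apply l hS, orliczIndicator_eq_zero hS h, map_zero]

theorem memOrlicz_simpleFunc (s : SimpleFunc Ω ℝ) : MemOrlicz φ μ s := by
  obtain ⟨C, hC⟩ := s.exists_forall_norm_le
  exact MemOrlicz.of_bound s.aestronglyMeasurable C (Eventually.of_forall hC)

/-- On bounded functions, every continuous functional on `L^φ` is integration against an `L¹`
density. -/
theorem exists_integrable_density (l : OrliczSpace φ μ →L[ℝ] ℝ) :
    ∃ g : Ω → ℝ, Integrable g μ ∧ ∀ (f : OrliczSpace φ μ) (C : ℝ), (∀ᵐ ω ∂μ, |f.1 ω| ≤ C) →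
      l f = ∫ ω, f.1 ω * g ω ∂μ := by
  set g := (functionalMeasure l).rnDeriv μ with hg
  have hgi : Integrable g μ := SignedMeasure.integrable_rnDeriv _ _
  have hset : ∀ {S : Set Ω} (hS : MeasurableSet S),
      l (orliczIndicator φ μ hS) = ∫ ω in S, g ω ∂μ := by
    intro S hS
    rw [← withDensityᵥ_apply hgi hS, ← functionalMeasure_apply l hS, hg,
      SignedMeasure.withDensityᵥ_rnDeriv_eq _ _ (functionalMeasure_absolutelyContinuous l)]
  have hsg : ∀ s : SimpleFunc Ω ℝ, Integrable (fun ω => s ω * g ω) μ := by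
    intro s
    obtain ⟨C, hC⟩ := s.exists_forall_norm_le
    exact hgi.bdd_mul s.aestronglyMeasurable (Eventually.of_forall hC)
  have hsimple : ∀ s : SimpleFunc Ω ℝ,
      l (memOrlicz_simpleFunc (φ := φ) (μ := μ) s).toOrlicz = ∫ ω, s ω * g ω ∂μ := by
    intro s
    induction s using SimpleFunc.induction with
    | const c hS =>
      rename_i S
      have e : (memOrlicz_simpleFunc (φ := φ) (μ := μ) (SimpleFunc.piecewise S hS
          (SimpleFunc.const Ω c) (SimpleFunc.const Ω 0))).toOrlicz =
          c • orliczIndicator φ μ hS := by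
        refine OrliczSpace.ext ?_
        filter_upwards [MemOrlicz.coeFn_toOrlicz (memOrlicz_simpleFunc (φ := φ) (μ := μ)
          (SimpleFunc.piecewise S hS (SimpleFunc.const Ω c) (SimpleFunc.const Ω 0))),
          orlicz_coe_smul c (orliczIndicator φ μ hS),
          coeFn_orliczIndicator (φ := φ) (μ := μ) hS] with ω h1 h2 h3
        rw [h1, h2, h3]
        by_cases hω : ω ∈ S <;> simp [hω]
      rw [e, map_smul, hset hS, smul_eq_mul, ← integral_const_mul, ← integral_indicator hS]
      refine integral_congr_ae (Eventually.of_forall fun ω => ?_)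
      by_cases hω : ω ∈ S <;> simp [hω]
    | add _ h1 h2 =>
      rename_i s t _
      have e : (memOrlicz_simpleFunc (φ := φ) (μ := μ) (s + t)).toOrlicz =
          (memOrlicz_simpleFunc (φ := φ) (μ := μ) s).toOrlicz +
            (memOrlicz_simpleFunc (φ := φ) (μ := μ) t).toOrlicz :=
        MemOrlicz.toOrlicz_add _ _ _
      rw [e, map_add, h1, h2, ← integral_add (hsg s) (hsg t)]
      refine integral_congr_ae (Eventually.of_forall fun ω => ?_)
      simp [add_mul]
  -- a bounded `f` is a pointwise limit of uniformly bounded simple functions `s n`; the left side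
  -- converges since `s n → f` in `L^φ`, the right side by dominated convergence
  refine ⟨g, hgi, fun f C hC => ?_⟩
  have hC' : ∀ᵐ ω ∂μ, ‖f.1 ω‖ ≤ max C 0 := hC.mono fun ω hω => hω.trans (le_max_left _ _)
  have hfm : StronglyMeasurable (f.1 : Ω → ℝ) := AEEqFun.stronglyMeasurable f.1
  set s : ℕ → SimpleFunc Ω ℝ := hfm.approxBounded (max C 0) with hs
  have hsb : ∀ n ω, ‖s n ω‖ ≤ max C 0 := fun n ω =>
    hfm.norm_approxBounded_le (le_max_right _ _) n ω
  have hslim : ∀ᵐ ω ∂μ, Tendsto (fun n => s n ω) atTop (𝓝 (f.1 ω)) := hC'.mono fun ω hω =>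
    hfm.tendsto_approxBounded_of_norm_le hω
  have hcoe : ∀ n, (((memOrlicz_simpleFunc (φ := φ) (μ := μ) (s n)).toOrlicz - f :
      OrliczSpace φ μ).1 : Ω → ℝ) =ᵐ[μ] fun ω => s n ω - f.1 ω := by
    intro n
    filter_upwards [OrliczSpace.coeFn_sub (memOrlicz_simpleFunc (φ := φ) (μ := μ) (s n)).toOrlicz f,
      MemOrlicz.coeFn_toOrlicz (memOrlicz_simpleFunc (φ := φ) (μ := μ) (s n))] with ω h1 h2
    rw [h1, h2]
  have hdiff : ∀ n, ∀ᵐ ω ∂μ, |s n ω - f.1 ω| ≤ max C 0 + max C 0 := fun n =>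
    hC'.mono fun ω hω => (abs_sub _ _).trans (add_le_add (hsb n ω) hω)
  have hnorm : Tendsto (fun n => (memOrlicz_simpleFunc (φ := φ) (μ := μ) (s n)).toOrlicz - f)
      atTop (𝓝 0) := by
    refine OrliczSpace.tendsto_zero_of_bounded (C := max C 0 + max C 0) (fun n => ?_) ?_
    · filter_upwards [hcoe n, hdiff n] with ω h1 h2
      rwa [h1]
    · have h0 : Tendsto (fun n => ∫ ω, |s n ω - f.1 ω| ∂μ) atTop (𝓝 (∫ _, (0 : ℝ) ∂μ)) := by
        refine tendsto_integral_of_dominated_convergence (fun _ => max C 0 + max C 0)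
          (fun n => ((s n).aestronglyMeasurable.sub hfm.aestronglyMeasurable).norm)
          (integrable_const _) (fun n => (hdiff n).mono fun ω hω => ?_) (hslim.mono fun ω hω => ?_)
        · rwa [Real.norm_eq_abs, abs_abs]
        · simpa using (hω.sub_const (f.1 ω)).abs
      rw [integral_zero] at h0
      refine h0.congr fun n => integral_congr_ae ?_
      filter_upwards [hcoe n] with ω h1
      rw [h1]
  have hl1 : Tendsto (fun n => ∫ ω, s n ω * g ω ∂μ) atTop (𝓝 (l f)) := by
    have h1 := (l.continuous.tendsto f).comp (tendsto_sub_nhds_zero_iff.1 hnorm)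
    exact h1.congr fun n => hsimple (s n)
  have hl2 : Tendsto (fun n => ∫ ω, s n ω * g ω ∂μ) atTop (𝓝 (∫ ω, f.1 ω * g ω ∂μ)) := by
    refine tendsto_integral_of_dominated_convergence (fun ω => max C 0 * |g ω|)
      (fun n => (hsg (s n)).1) (hgi.abs.const_mul _)
      (fun n => Eventually.of_forall fun ω => ?_) (hslim.mono fun ω hω => hω.mul_const _)
    rw [norm_mul]
    exact mul_le_mul_of_nonneg_right (hsb n ω) (abs_nonneg _)
  exact tendsto_nhds_unique hl1 hl2

/-- Integration against a bounded function is a continuous functional on `L^φ`. -/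
theorem exists_functional_eq_integral_mul {g : Ω → ℝ} (hg : AEStronglyMeasurable g μ) {C : ℝ}
    (hC : ∀ᵐ ω ∂μ, |g ω| ≤ C) :
    ∃ l : OrliczSpace φ μ →L[ℝ] ℝ, ∀ f, l f = ∫ ω, f.1 ω * g ω ∂μ := by
  obtain ⟨K, hK0, hK⟩ := OrliczSpace.exists_integral_abs_le (φ := φ) (μ := μ)
  have hint : ∀ f : OrliczSpace φ μ, Integrable (fun ω => f.1 ω * g ω) μ := fun f =>
    f.integrable.mul_bdd hg hC
  let l₀ : OrliczSpace φ μ →ₗ[ℝ] ℝ :=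
    { toFun := fun f => ∫ ω, f.1 ω * g ω ∂μ
      map_add' := fun f f' => by
        rw [← integral_add (hint f) (hint f')]
        refine integral_congr_ae ?_
        filter_upwards [OrliczSpace.coeFn_add f f'] with ω hω
        rw [hω, add_mul]
      map_smul' := fun c f => by
        rw [RingHom.id_apply, smul_eq_mul, ← integral_const_mul]
        refine integral_congr_ae ?_
        filter_upwards [orlicz_coe_smul c f] with ω hω
        rw [hω, mul_assoc] }
  refine ⟨l₀.mkContinuous (max C 0 * K) fun f => ?_, fun f => rfl⟩
  calc ‖l₀ f‖ ≤ ∫ ω, ‖f.1 ω * g ω‖ ∂μ := norm_integral_le_integral_norm _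
    _ ≤ ∫ ω, max C 0 * |f.1 ω| ∂μ := by
        refine integral_mono_ae (hint f).norm (f.integrable.abs.const_mul _) ?_
        filter_upwards [hC] with ω hω
        rw [norm_mul, mul_comm, Real.norm_eq_abs, Real.norm_eq_abs]
        exact mul_le_mul_of_nonneg_right (hω.trans (le_max_left _ _)) (abs_nonneg _)
    _ ≤ max C 0 * K * ‖f‖ := by
        rw [integral_const_mul, mul_assoc]
        exact mul_le_mul_of_nonneg_left (hK f) (le_max_right _ _)

end functionals

/-! ### Conditional expectations in `L¹` -/

section condExpL1

variable {μ : Measure Ω}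

theorem ae_abs_indicator_sub_condExp_le (D : MeasurableSpace Ω) (S : Set Ω) :
    ∀ᵐ ω ∂μ, |S.indicator (fun _ => (1 : ℝ)) ω - (μ[S.indicator fun _ => (1 : ℝ) | D]) ω| ≤ 2 := by
  have hb : ∀ ω, |S.indicator (fun _ => (1 : ℝ)) ω| ≤ 1 := fun ω => by
    by_cases h : ω ∈ S <;> simp [h]
  filter_upwards [ae_bdd_abs_condExp_of_ae_bdd_abs (m := D) (Eventually.of_forall hb)] with ω hω
  linarith [abs_sub (S.indicator (fun _ => (1 : ℝ)) ω) ((μ[S.indicator fun _ => (1 : ℝ) | D]) ω),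
    hb ω]

theorem MeasureTheory.Integrable.exists_bounded_integral_abs_sub_lt {g : Ω → ℝ}
    (hg : Integrable g μ) {ε : ℝ} (hε : 0 < ε) :
    ∃ (b : Ω → ℝ) (C : ℝ), AEStronglyMeasurable b μ ∧ (∀ ω, |b ω| ≤ C) ∧
      ∫ ω, |g ω - b ω| ∂μ < ε := by
  obtain ⟨b, hb, hbi⟩ := (memLp_one_iff_integrable.2 hg).exists_simpleFunc_eLpNorm_sub_lt
    ENNReal.one_ne_top (ε := ENNReal.ofReal ε) (by simpa using hε)
  obtain ⟨C, hC⟩ := b.exists_forall_norm_le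
  refine ⟨b, C, b.aestronglyMeasurable, hC, ?_⟩
  rw [eLpNorm_one_eq_lintegral_enorm, ← ofReal_integral_norm_eq_lintegral_enorm
    (hg.sub (memLp_one_iff_integrable.1 hbi)), ENNReal.ofReal_lt_ofReal_iff hε] at hb
  exact hb

variable [IsFiniteMeasure μ]

/-- Conditional expectation is self-adjoint for the pairing of bounded with integrable
functions. -/
theorem integral_condExp_mul_eq_integral_mul_condExp {m : MeasurableSpace Ω} (hm : m ≤ mΩ)
    {f g : Ω → ℝ} (hf : AEStronglyMeasurable[mΩ] f μ) {C : ℝ} (hC : ∀ᵐ ω ∂μ, |f ω| ≤ C)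
    (hg : Integrable g μ) :
    ∫ ω, (μ[f | m]) ω * g ω ∂μ = ∫ ω, f ω * (μ[g | m]) ω ∂μ := by
  have hfi : Integrable f μ := Integrable.of_bound hf C hC
  have h1 : Integrable (μ[f | m] * g) μ :=
    hg.bdd_mul integrable_condExp.1 (ae_bdd_abs_condExp_of_ae_bdd_abs (m := m) hC)
  have h2 : Integrable (f * μ[g | m]) μ := integrable_condExp.bdd_mul hf hC
  calc ∫ ω, (μ[f | m]) ω * g ω ∂μ = ∫ ω, (μ[μ[f | m] * g | m]) ω ∂μ := (integral_condExp hm).symm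
    _ = ∫ ω, (μ[f * μ[g | m] | m]) ω ∂μ := integral_congr_ae
        ((condExp_mul_of_stronglyMeasurable_left stronglyMeasurable_condExp h1 hg).trans
          (condExp_mul_of_stronglyMeasurable_right stronglyMeasurable_condExp h2 hfi).symm)
    _ = ∫ ω, f ω * (μ[g | m]) ω ∂μ := integral_condExp hm

/-- The identity that turns the pairing of `χ_S - E(χ_S | D)` with `g` into the integral over
`S` of the conditional expectation of `g - E(g | D)`. -/
theorem integral_indicator_sub_condExp_mul {m D : MeasurableSpace Ω} (hm : m ≤ mΩ) (hD : D ≤ mΩ)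
    {S : Set Ω} (hS : MeasurableSet[m] S) {g : Ω → ℝ} (hg : Integrable g μ) :
    ∫ ω, (S.indicator (fun _ => (1 : ℝ)) ω - (μ[S.indicator fun _ => (1 : ℝ) | D]) ω) * g ω ∂μ =
      ∫ ω in S, (μ[g - μ[g | D] | m]) ω ∂μ := by
  have hS' : MeasurableSet[mΩ] S := hm S hS
  set χ : Ω → ℝ := S.indicator fun _ => (1 : ℝ) with hχ
  have hχm : AEStronglyMeasurable[mΩ] χ μ := aestronglyMeasurable_const.indicator hS'
  have hχb : ∀ᵐ ω ∂μ, |χ ω| ≤ 1 := Eventually.of_forall fun ω => by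
    by_cases h : ω ∈ S <;> simp [hχ, h]
  have hmul : ∀ h : Ω → ℝ, ∫ ω, χ ω * h ω ∂μ = ∫ ω in S, h ω ∂μ := by
    intro h
    rw [← integral_indicator hS']
    refine integral_congr_ae (Eventually.of_forall fun ω => ?_)
    by_cases hω : ω ∈ S <;> simp [hχ, hω]
  have h1 : Integrable (fun ω => χ ω * g ω) μ := hg.bdd_mul hχm hχb
  have h2 : Integrable (fun ω => (μ[χ | D]) ω * g ω) μ :=
    hg.bdd_mul integrable_condExp.1 (ae_bdd_abs_condExp_of_ae_bdd_abs (m := D) hχb)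
  simp_rw [sub_mul]
  rw [integral_sub h1 h2, integral_condExp_mul_eq_integral_mul_condExp hD hχm hχb hg, hmul, hmul,
    setIntegral_condExp hm (hg.sub integrable_condExp) hS,
    ← integral_sub hg.integrableOn integrable_condExp.integrableOn]
  rfl

/-- For `D` the lower limit of the `A n` and `h = E(g | D)`, the conditional expectations
`E(h | A n)` converge to `h` in `L¹`.  By the upward martingale theorem
`h` is close to `E(h | ⋂_{n ≥ m} A n)` for large `m`, and the latter is fixed by `E(· | A n)` as
soon as `n ≥ m`. -/
theorem tendsto_integral_abs_condExp_condExp_lowerLimit_sub {A : ℕ → MeasurableSpace Ω}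
    (hA : ∀ n, A n ≤ mΩ) (g : Ω → ℝ) :
    Tendsto (fun n => ∫ ω, |(μ[μ[g | lowerLimit A] | A n]) ω - (μ[g | lowerLimit A]) ω| ∂μ) atTop
      (𝓝 0) := by
  let ℱ : Filtration ℕ mΩ :=
    { seq := fun m => ⨅ n : ℕ, ⨅ _ : m ≤ n, A n
      mono' := fun i j hij => le_iInf₂ fun n hn => iInf₂_le n (hij.trans hn)
      le' := fun m => (iInf₂_le m le_rfl).trans (hA m) }
  have hℱ : (⨆ m, ℱ m) = lowerLimit A := rfl
  set h : Ω → ℝ := μ[g | lowerLimit A] with hh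
  have hhi : Integrable h μ := integrable_condExp
  have hup : Tendsto (fun m => ∫ ω, |(μ[h | ℱ m]) ω - h ω| ∂μ) atTop (𝓝 0) := by
    have h1 := hhi.tendsto_eLpNorm_condExp (ℱ := ℱ)
      (by rw [hℱ]; exact stronglyMeasurable_condExp)
    have h2 := (ENNReal.tendsto_toReal ENNReal.zero_ne_top).comp h1
    refine h2.congr fun m => ?_
    rw [Function.comp_apply, eLpNorm_one_eq_lintegral_enorm,
      ← integral_norm_eq_lintegral_enorm (integrable_condExp.sub hhi).1]
    rfl
  rw [Metric.tendsto_atTop]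
  intro ε hε
  obtain ⟨m, hm⟩ := (hup.eventually_lt_const (half_pos hε)).exists
  refine ⟨m, fun n hn => ?_⟩
  set b : Ω → ℝ := μ[h | ℱ m] with hb
  have hbi : Integrable b μ := integrable_condExp
  have hbm : StronglyMeasurable[A n] b :=
    stronglyMeasurable_condExp.mono (iInf₂_le n hn : (ℱ m : MeasurableSpace Ω) ≤ A n)
  have hfix : μ[b | A n] = b := condExp_of_stronglyMeasurable (hA n) hbm hbi
  have hsub := condExp_sub hbi hhi (A n)
  -- `E(h | A n) - h = -E(b - h | A n) + (b - h)`, as `E(b | A n) = b`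
  have hle : ∫ ω, |(μ[h | A n]) ω - h ω| ∂μ ≤
      ∫ ω, |(μ[b - h | A n]) ω| ∂μ + ∫ ω, |b ω - h ω| ∂μ := by
    have hbh : Integrable (fun ω => |b ω - h ω|) μ := (hbi.sub hhi).abs
    rw [← integral_add integrable_condExp.abs hbh]
    refine integral_mono_ae (integrable_condExp.sub hhi).abs
      (integrable_condExp.abs.add hbh) ?_
    filter_upwards [hsub] with ω hω
    rw [hfix] at hω
    simp only [hω, Pi.sub_apply]
    have e : (μ[h | A n]) ω - h ω = -(b ω - (μ[h | A n]) ω) + (b ω - h ω) := by ring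
    rw [e]
    exact (abs_add_le _ _).trans_eq (by rw [abs_neg])
  have hcon : ∫ ω, |(μ[b - h | A n]) ω| ∂μ ≤ ∫ ω, |b ω - h ω| ∂μ := integral_abs_condExp_le _
  rw [Real.dist_0_eq_abs, abs_of_nonneg (integral_nonneg fun ω => abs_nonneg _)]
  linarith

end condExpL1

/-! ### Orthogonal convergence and convergence of conditional expectations -/

section orthogonal

variable {φ : YoungFunction} {μ : Measure Ω} [IsFiniteMeasure μ]

theorem coeFn_orliczCondExpPerp_orliczIndicator (D : MeasurableSpace Ω) {S : Set Ω}
    (hS : MeasurableSet[mΩ] S) :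
    ((orliczCondExpPerp φ μ D (orliczIndicator φ μ hS)).1 : Ω → ℝ) =ᵐ[μ]
      fun ω => S.indicator (fun _ => (1 : ℝ)) ω - (μ[S.indicator fun _ => (1 : ℝ) | D]) ω := by
  filter_upwards [coeFn_orliczIndicator (φ := φ) (μ := μ) hS,
    OrliczSpace.coeFn_sub (orliczIndicator φ μ hS) (orliczCondExp φ μ D (orliczIndicator φ μ hS)),
    coeFn_orliczCondExp_toOrlicz D (memOrlicz_indicator φ μ hS)] with ω h1 h2 h3
  rw [orliczCondExpPerp, h2, h1, orliczIndicator, h3]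

/-- Orthogonal convergence, tested on the sets where `E(g - E(g | D) | A n)` has a fixed sign,
makes these conditional expectations small in `L¹`. -/
theorem OrthogonallyConverges.tendsto_integral_abs_condExp {A : ℕ → MeasurableSpace Ω}
    {hA : ∀ n, A n ≤ mΩ} {D : MeasurableSpace Ω} (hD : D ≤ mΩ)
    (h : OrthogonallyConverges φ μ A hA D) {g : Ω → ℝ} (hg : AEStronglyMeasurable[mΩ] g μ) {C : ℝ}
    (hC : ∀ᵐ ω ∂μ, |g ω| ≤ C) :
    Tendsto (fun n => ∫ ω, |(μ[g - μ[g | D] | A n]) ω| ∂μ) atTop (𝓝 0) := by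
  have hgi : Integrable g μ := Integrable.of_bound hg C hC
  obtain ⟨l, hl⟩ := exists_functional_eq_integral_mul (φ := φ) hg hC
  have hset : ∀ S : ℕ → Set Ω, (∀ n, MeasurableSet[A n] (S n)) →
      Tendsto (fun n => ∫ ω in S n, (μ[g - μ[g | D] | A n]) ω ∂μ) atTop (𝓝 0) := by
    intro S hS
    have h1 := h S hS l
    rw [map_zero] at h1
    refine h1.congr fun n => ?_
    rw [hl, ← integral_indicator_sub_condExp_mul (hA n) hD (hS n) hgi]
    refine integral_congr_ae ?_
    filter_upwards [coeFn_orliczCondExpPerp_orliczIndicator (φ := φ) (μ := μ) D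
      (hA n (S n) (hS n))] with ω hω
    rw [hω]
  have hpos := hset (fun n => {ω | 0 ≤ (μ[g - μ[g | D] | A n]) ω}) fun n =>
    stronglyMeasurable_const.measurableSet_le stronglyMeasurable_condExp
  have hneg := hset (fun n => {ω | (μ[g - μ[g | D] | A n]) ω ≤ 0}) fun n =>
    stronglyMeasurable_condExp.measurableSet_le stronglyMeasurable_const
  have hsub := hpos.sub hneg
  rw [sub_zero] at hsub
  exact hsub.congr fun n => (integral_norm_eq_pos_sub_neg integrable_condExp).symm

/-- Orthogonal convergence to the lower limit gives norm convergence of the conditional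
expectations of bounded functions. -/
theorem OrthogonallyConverges.tendsto_orliczCondExp_of_bounded {A : ℕ → MeasurableSpace Ω}
    {hA : ∀ n, A n ≤ mΩ} (h : OrthogonallyConverges φ μ A hA (lowerLimit A))
    {g : OrliczSpace φ μ} {C : ℝ} (hC : ∀ᵐ ω ∂μ, |g.1 ω| ≤ C) :
    Tendsto (fun n => orliczCondExp φ μ (A n) g) atTop
      (𝓝 (orliczCondExp φ μ (lowerLimit A) g)) := by
  have hD : lowerLimit A ≤ mΩ := iSup_le fun m => (iInf₂_le m le_rfl).trans (hA m)
  set D := lowerLimit A with hDdef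
  have hgi := g.integrable
  have hcoe : ∀ n, ((orliczCondExp φ μ (A n) g - orliczCondExp φ μ D g : OrliczSpace φ μ).1 :
      Ω → ℝ) =ᵐ[μ] fun ω => (μ[g.1 | A n]) ω - (μ[g.1 | D]) ω := by
    intro n
    filter_upwards [OrliczSpace.coeFn_sub (orliczCondExp φ μ (A n) g) (orliczCondExp φ μ D g),
      coeFn_orliczCondExp (A n) g, coeFn_orliczCondExp D g] with ω h1 h2 h3
    rw [h1, h2, h3]
  rw [← tendsto_sub_nhds_zero_iff]
  refine OrliczSpace.tendsto_zero_of_bounded (C := C + C) (fun n => ?_) ?_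
  · filter_upwards [hcoe n, ae_bdd_abs_condExp_of_ae_bdd_abs (m := A n) hC, ae_bdd_abs_condExp_of_ae_bdd_abs (m := D) hC] with ω h1 h2 h3
    rw [h1]
    exact (abs_sub _ _).trans (add_le_add h2 h3)
  · have h1 := h.tendsto_integral_abs_condExp hD hgi.1 hC
    have h2 := tendsto_integral_abs_condExp_condExp_lowerLimit_sub (μ := μ) hA (g.1 : Ω → ℝ)
    have h3 := h1.add h2
    rw [add_zero] at h3
    refine squeeze_zero (fun n => integral_nonneg fun ω => abs_nonneg _) (fun n => ?_) h3
    have hi : Integrable (fun ω => |(μ[μ[g.1 | D] | A n]) ω - (μ[g.1 | D]) ω|) μ :=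
      (integrable_condExp.sub integrable_condExp).abs
    rw [← integral_add integrable_condExp.abs hi]
    refine integral_mono_ae (OrliczSpace.integrable _).abs
      (integrable_condExp.abs.add hi) ?_
    filter_upwards [hcoe n, condExp_sub hgi (integrable_condExp (f := (g.1 : Ω → ℝ)) (m := D))
      (A n)] with ω h4 h5
    simp only [h4, h5, Pi.sub_apply]
    refine le_trans (le_of_eq (congrArg _ ?_)) (abs_add_le _ _)
    ring

/-- Norm convergence on a dense set of functions extends to all of `L^φ`, the conditional
expectations being contractions. -/
theorem OrthogonallyConverges.tendsto_orliczCondExp (hφ : φ.DeltaTwo) {A : ℕ → MeasurableSpace Ω}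
    {hA : ∀ n, A n ≤ mΩ} (h : OrthogonallyConverges φ μ A hA (lowerLimit A))
    (f : OrliczSpace φ μ) :
    Tendsto (fun n => orliczCondExp φ μ (A n) f) atTop
      (𝓝 (orliczCondExp φ μ (lowerLimit A) f)) := by
  have hD : lowerLimit A ≤ mΩ := iSup_le fun m => (iInf₂_le m le_rfl).trans (hA m)
  rw [Metric.tendsto_nhds]
  intro ε hε
  obtain ⟨g, C, hC, hfg⟩ := OrliczSpace.exists_bounded_norm_sub_le hφ f (by positivity : 0 < ε / 3)
  have hcontr : ∀ m : MeasurableSpace Ω, m ≤ mΩ →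
      dist (orliczCondExp φ μ m f) (orliczCondExp φ μ m g) ≤ ε / 3 := fun m hm => by
    rw [dist_eq_norm, ← orliczCondExp_sub]
    exact (norm_orliczCondExp_le hm _).trans hfg
  filter_upwards [Metric.tendsto_nhds.1 (h.tendsto_orliczCondExp_of_bounded hC) (ε / 3)
    (by positivity)] with n hn
  have h1 := hcontr (A n) (hA n)
  have h2 := hcontr (lowerLimit A) hD
  have h3 := dist_triangle4_right (orliczCondExp φ μ (A n) f)
    (orliczCondExp φ μ (lowerLimit A) f) (orliczCondExp φ μ (A n) g)
    (orliczCondExp φ μ (lowerLimit A) g)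
  linarith

/-- For a bounded density `b` the pairing is the integral over `S n` of
`E(b - E(b | D) | A n)`, which converges in `L¹` to `E(b - E(b | D) | D) = 0`. -/
theorem tendsto_integral_indicator_sub_condExp_mul_of_bounded {A : ℕ → MeasurableSpace Ω}
    (hA : ∀ n, A n ≤ mΩ) {D : MeasurableSpace Ω} (hD : D ≤ mΩ)
    (h : ∀ f : OrliczSpace φ μ, Tendsto (fun n => orliczCondExp φ μ (A n) f) atTop
      (𝓝 (orliczCondExp φ μ D f)))
    {S : ℕ → Set Ω} (hS : ∀ n, MeasurableSet[A n] (S n)) {b : Ω → ℝ}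
    (hb : AEStronglyMeasurable[mΩ] b μ) {C : ℝ} (hC : ∀ᵐ ω ∂μ, |b ω| ≤ C) :
    Tendsto (fun n => ∫ ω, ((S n).indicator (fun _ => (1 : ℝ)) ω -
      (μ[(S n).indicator fun _ => (1 : ℝ) | D]) ω) * b ω ∂μ) atTop (𝓝 0) := by
  have hbm : MemOrlicz φ μ b := MemOrlicz.of_bound hb C hC
  have hbi : Integrable b μ := hbm.integrable
  have hdm : MemOrlicz φ μ (b - μ[b | D]) := by
    refine (hbm.add ((MemOrlicz.condExp D hbm).const_mul (-1))).congr
      (Eventually.of_forall fun ω => ?_)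
    simp only [Pi.sub_apply]
    ring
  have hzero : μ[b - μ[b | D] | D] =ᵐ[μ] 0 := by
    filter_upwards [condExp_sub hbi (integrable_condExp (f := b) (m := D)) D,
      condExp_condExp_of_le (f := b) (μ := μ) (le_refl D) hD] with ω h1 h2
    rw [h1, Pi.sub_apply, h2, sub_self, Pi.zero_apply]
  have h1 := OrliczSpace.tendsto_integral_abs_sub (h hdm.toOrlicz)
  refine squeeze_zero_norm (fun n => ?_) h1
  rw [integral_indicator_sub_condExp_mul (hA n) hD (hS n) hbi]
  calc ‖∫ ω in S n, (μ[b - μ[b | D] | A n]) ω ∂μ‖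
      ≤ ∫ ω in S n, ‖(μ[b - μ[b | D] | A n]) ω‖ ∂μ := norm_integral_le_integral_norm _
    _ ≤ ∫ ω, ‖(μ[b - μ[b | D] | A n]) ω‖ ∂μ :=
        setIntegral_le_integral integrable_condExp.norm
          (Eventually.of_forall fun ω => norm_nonneg _)
    _ = _ := by
        refine integral_congr_ae ?_
        filter_upwards [coeFn_orliczCondExp_toOrlicz (A n) hdm,
          coeFn_orliczCondExp_toOrlicz D hdm, hzero] with ω h2 h3 h4
        rw [h2, h3, h4, Pi.zero_apply, sub_zero, Real.norm_eq_abs]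

/-- Norm convergence of the conditional expectations gives orthogonal convergence.  A continuous
functional has an `L¹` density on bounded functions; since `|χ_S - E(χ_S | D)| ≤ 2`, replacing it by
an `L¹`-close bounded density changes the pairings uniformly little. -/
theorem orthogonallyConverges_of_tendsto_orliczCondExp {A : ℕ → MeasurableSpace Ω}
    {hA : ∀ n, A n ≤ mΩ} {D : MeasurableSpace Ω} (hD : D ≤ mΩ)
    (h : ∀ f : OrliczSpace φ μ, Tendsto (fun n => orliczCondExp φ μ (A n) f) atTop
      (𝓝 (orliczCondExp φ μ D f))) :
    OrthogonallyConverges φ μ A hA D := by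
  intro S hS l
  rw [map_zero]
  obtain ⟨g, hgi, hg⟩ := exists_integrable_density l
  set p : ℕ → Ω → ℝ := fun n ω => (S n).indicator (fun _ => (1 : ℝ)) ω -
    (μ[(S n).indicator fun _ => (1 : ℝ) | D]) ω with hp
  have hpb : ∀ n, ∀ᵐ ω ∂μ, |p n ω| ≤ 2 := fun n => ae_abs_indicator_sub_condExp_le D (S n)
  have hpm : ∀ n, AEStronglyMeasurable[mΩ] (p n) μ := fun n =>
    (aestronglyMeasurable_const.indicator (hA n (S n) (hS n))).sub integrable_condExp.1
  have hlp : ∀ n, l (orliczCondExpPerp φ μ D (orliczIndicator φ μ (hA n (S n) (hS n)))) =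
      ∫ ω, p n ω * g ω ∂μ := by
    intro n
    have hc := coeFn_orliczCondExpPerp_orliczIndicator (φ := φ) (μ := μ) D (hA n (S n) (hS n))
    rw [hg _ 2 (by filter_upwards [hc, hpb n] with ω h1 h2; rwa [h1])]
    refine integral_congr_ae ?_
    filter_upwards [hc] with ω h1
    rw [h1]
  simp_rw [hlp]
  rw [Metric.tendsto_nhds]
  intro ε hε
  obtain ⟨b, C, hbm, hC, hgb⟩ := hgi.exists_bounded_integral_abs_sub_lt (ε := ε / 4) (by positivity)
  have hbi : Integrable b μ := Integrable.of_bound hbm C (Eventually.of_forall hC)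
  have hlim := tendsto_integral_indicator_sub_condExp_mul_of_bounded hA hD h hS hbm
    (Eventually.of_forall hC)
  filter_upwards [Metric.tendsto_nhds.1 hlim (ε / 2) (half_pos hε)] with n hn
  rw [Real.dist_0_eq_abs] at hn ⊢
  have hi1 : Integrable (fun ω => p n ω * b ω) μ := hbi.bdd_mul (hpm n) (hpb n)
  have hi2 : Integrable (fun ω => p n ω * (g ω - b ω)) μ := (hgi.sub hbi).bdd_mul (hpm n) (hpb n)
  have hsplit : ∫ ω, p n ω * g ω ∂μ = ∫ ω, p n ω * b ω ∂μ + ∫ ω, p n ω * (g ω - b ω) ∂μ := by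
    rw [← integral_add hi1 hi2]
    refine integral_congr_ae (Eventually.of_forall fun ω => ?_)
    simp only []
    ring
  have herr : |∫ ω, p n ω * (g ω - b ω) ∂μ| ≤ 2 * ∫ ω, |g ω - b ω| ∂μ := by
    rw [← integral_const_mul]
    refine (norm_integral_le_integral_norm _).trans
      (integral_mono_ae hi2.norm ((hgi.sub hbi).abs.const_mul 2) ?_)
    filter_upwards [hpb n] with ω hω
    rw [norm_mul]
    exact mul_le_mul_of_nonneg_right hω (abs_nonneg _)
  rw [hsplit]
  linarith [abs_add_le (∫ ω, p n ω * b ω ∂μ) (∫ ω, p n ω * (g ω - b ω) ∂μ)]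

end orthogonal

end

theorem mainTheorem3 {Ω : Type*} {mΩ : MeasurableSpace Ω} (μ : Measure Ω) [IsFiniteMeasure μ]
    (φ : YoungFunction) (hφ : φ.DeltaTwo)
    (A : ℕ → MeasurableSpace Ω) (hA : ∀ n, A n ≤ mΩ) :
    OrthogonallyConverges φ μ A hA (lowerLimit A) ↔
      ∀ f : OrliczSpace φ μ,
        Tendsto (fun n => orliczCondExp φ μ (A n) f) atTop
          (𝓝 (orliczCondExp φ μ (lowerLimit A) f)) :=
  ⟨fun h => h.tendsto_orliczCondExp hφ, orthogonallyConverges_of_tendsto_orliczCondExp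
    (iSup_le fun m => (iInf₂_le m le_rfl).trans (hA m))⟩
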